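/- **Proposition 2.** Fix real numbers $0<c<a$ and $\lambda\in\{0,1\}$. For $n\in\mathbb N$ let $N=\{1,\dots,n\}$ be a set of firms with unit cost $c$ that sell a homogeneous good with inverse demand intercept $a$. For $1\le s\le n$ let $K_{n-s,j}$ be the Stirling numbers of the second kind, let $\Pi_j=j\,\frac{(a-c)^2}{(j+2)^2}$ be the total Cournot profits of $j$ firms in a market with $j+1$ competing firms, and put $$f^\lambda_{n,s}(j)=\frac{\exp(\lambda\Pi_j)\,K_{n-s,j}}{\sum_{m=0}^{n-s}\exp(\lambda\Pi_m)\,K_{n-s,m}},\qquad 0\le j\le n-s ,$$ the probability that the $n-s$ outsiders of a coalition with $s$ members form $j$ coalitions ($\lambda=0$: uniform over partitions; $\lambda=1$: logit). Thus $f^\lambda_{n,s}(0)=0$ for $s<n$ and $f^\lambda_{n,n}(0)=1$. For any family $z=(z_{n,s})_{1\le s\le n}$ of probability distributions $z_{n,s}$ on $\{0,1,\dots,n-s\}$ with $z_{n,s}(0)=0$ for $s<n$, let $(N,v_z)$ be the transferable-utility game with $v_z(\emptyset)=0$ and, for $|S|=s\ge 1$, $$v_z(S)=(a-c)^2\,\frac{1-F}{(2-F)^2}\,\sum_{j=0}^{n-s}\frac{z_{n,s}(j)}{j+1},\qquad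 F=\sum_{j=0}^{n-s}\frac{j\,z_{n,s}(j)}{j+1}.$$ This is the expected profit of $S$ in the unique equilibrium in which $S$ chooses $q_S\ge 0$ to maximize $\sum_j z_{n,s}(j)\,(a-q_S-Q_j-c)\,q_S$, where $Q_j$ is the total quantity of the outside coalitions when there are $j$ of them, and simultaneously, for each $j$, each of these $j$ coalitions chooses a quantity $q\ge0$ to maximize $(a-q_S-Q_j-c)\,q$. Let $$C_z=\Big\{x\in\mathbb R^N:\ \sum_{i\in N}x_i=v_z(N),\ \sum_{i\in S}x_i\ge v_z(S)\ \text{for all } S\subseteq N\Big\}$$ be its core, and let $C_{f^\lambda}$ be the core for $z=f^\lambda$. Say that $z$ dominates $f^\lambda$ at first order (for $n$ firms) if $\sum_{j\le j^*}z_{n,s}(j)\le\sum_{j\le j^*}f^\lambda_{n,s}(j)$ for all $1\le s\le n$ and all $j^*\le n-s$. Then: 1. There is $n_0$, depending only on $a$, $c$ and $\lambda$, such that for all $n\ge n_0$ and every $z$ that dominates $f^\lambda$ at first order, $C_z\ne\emptyset$. 2. For every $n$ and every $z$ that dominates $f^\lambda$ at first order, $C_{f^\lambda}\subseteq C_z$.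 3. In particular, for every $n$, $C_{f^\lambda}$ is contained in the $\gamma$-core, i.e. in the core for the degenerate distributions $\tilde z_{n,s}(n-s)=1$ (all outsiders stay singletons). -/

import Mathlib

open Finset

noncomputable section

namespace CournotCore

/-- `IsNash A q`: simultaneous quantity competition between `k` firms with quantities `q i ≥ 0`,
where a firm producing `x` earns `(A - (quantity of the other firms) - x) * x`.  Here `A` is the
intercept of the inverse demand net of the unit cost (and net of the quantity of a further firm
that is taken as given, if there is one). -/
def IsNash {k : ℕ} (A : ℝ) (q : Fin k → ℝ) : Prop :=
  ∀ i, 0 ≤ q i ∧ ∀ x : ℝ, 0 ≤ x →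
    (A - ∑ r ∈ univ.erase i, q r - x) * x ≤ (A - ∑ r ∈ univ.erase i, q r - q i) * q i

/-- Expected profit of the deviant coalition that produces `x`, when it faces `j` outside coalitions
with quantities `q j` with probability `f j`, `0 ≤ j ≤ m`. -/
def expectedProfit (a c : ℝ) (m : ℕ) (f : ℕ → ℝ) (q : (j : ℕ) → Fin j → ℝ) (x : ℝ) : ℝ :=
  ∑ j ∈ range (m + 1), f j * ((a - x - ∑ i, q j i - c) * x)

/-- Equilibrium of the quantity-setting stage: `qs` maximizes the expected profit of the deviant
coalition, and in every structure with `j ≤ m` outside coalitions each of these maximizes its own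
profit given `qs` and the other quantities. -/
def IsEquilibrium (a c : ℝ) (m : ℕ) (f : ℕ → ℝ) (qs : ℝ) (q : (j : ℕ) → Fin j → ℝ) : Prop :=
  (0 ≤ qs ∧ ∀ x : ℝ, 0 ≤ x → expectedProfit a c m f q x ≤ expectedProfit a c m f q qs) ∧
    ∀ j ≤ m, IsNash (a - qs - c) (q j)

/-- `f` is a probability distribution on the possible numbers `0, …, m` of coalitions that `m`
outsiders form: the value `0` is possible only if there are no outsiders. -/
def IsDistribution (m : ℕ) (f : ℕ → ℝ) : Prop :=
  (∀ j ≤ m, 0 ≤ f j) ∧ (0 < m → f 0 = 0) ∧ ∑ j ∈ range (m + 1), f j = 1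

/-- `F_f = ∑ j f(j) / (j + 1)`. -/
def bigF (m : ℕ) (f : ℕ → ℝ) : ℝ :=
  ∑ j ∈ range (m + 1), (j : ℝ) * f j / ((j : ℝ) + 1)

/-- The worth of a non-empty coalition that faces `m` outsiders and believes that they form `j`
coalitions with probability `f j`.  It is the coalition's expected profit in the unique equilibrium,
see `exists_isEquilibrium` and `expectedProfit_eq_value` below. -/
def value (a c : ℝ) (m : ℕ) (f : ℕ → ℝ) : ℝ :=
  (a - c) ^ 2 * ((1 - bigF m f) / (2 - bigF m f) ^ 2) *
    ∑ j ∈ range (m + 1), f j / ((j : ℝ) + 1)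

/-- `Π_j`: total Cournot profits of `j` firms in a market with `j + 1` competing firms, see
`outsidersProfit_eq_of_isNash` below. -/
def outsidersProfit (a c : ℝ) (j : ℕ) : ℝ :=
  (j : ℝ) * ((a - c) / ((j : ℝ) + 2)) ^ 2

/-- The distribution of the number of coalitions formed by the `n - s` outsiders: a structure with
`j` coalitions has weight `exp (lam * Π_j)`, and there are `Nat.stirlingSecond (n - s) j` of them.
It is uniform over structures for `lam = 0` and logit for `lam = 1`.  The index `0` matters only for
`s = n`, where it makes the distribution the point mass at `0` (no outside coalition). -/
def beliefs (a c lam : ℝ) (n s j : ℕ) : ℝ :=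
  Real.exp (lam * outsidersProfit a c j) * (Nat.stirlingSecond (n - s) j : ℝ) /
    ∑ m ∈ range (n - s + 1),
      Real.exp (lam * outsidersProfit a c m) * (Nat.stirlingSecond (n - s) m : ℝ)

/-- The beliefs behind the γ-core: all outsiders stay singletons. -/
def singletonBeliefs (n s j : ℕ) : ℝ := if j = n - s then 1 else 0

/-- The characteristic function of the game with `n` firms in which a coalition with `s` members has
beliefs `z s` over the number of outside coalitions. -/
def worth (a c : ℝ) (n : ℕ) (z : ℕ → ℕ → ℝ) (S : Finset (Fin n)) : ℝ :=
  if S = ∅ then 0 else value a c (n - S.card) (z S.card)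

/-- The core of a transferable-utility game on the player set `Fin n`. -/
def core {n : ℕ} (v : Finset (Fin n) → ℝ) : Set (Fin n → ℝ) :=
  {x | ∑ i, x i = v univ ∧ ∀ S : Finset (Fin n), v S ≤ ∑ i ∈ S, x i}

/-- `z` is a system of beliefs for the game with `n` firms: a distribution for each size `s` of a
deviant coalition. -/
def IsBeliefSystem (n : ℕ) (z : ℕ → ℕ → ℝ) : Prop :=
  ∀ s, 1 ≤ s → s ≤ n → IsDistribution (n - s) (z s)

/-- First-order dominance of `z s` over `f s` for every coalition size `s`. -/
def Dominates (n : ℕ) (z f : ℕ → ℕ → ℝ) : Prop :=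
  ∀ s, 1 ≤ s → s ≤ n → ∀ k ≤ n - s,
    ∑ j ∈ range (k + 1), z s j ≤ ∑ j ∈ range (k + 1), f s j

/-! The value function and the outsiders' profits are the equilibrium ones. -/

theorem isMax_iff (B y : ℝ) :
    (0 ≤ y ∧ ∀ x : ℝ, 0 ≤ x → (B - x) * x ≤ (B - y) * y) ↔ y = max (B / 2) 0 := by
  constructor
  · rintro ⟨hy, h⟩
    rcases le_total 0 B with hB | hB
    · rw [max_eq_left (by linarith)]
      have := h (B / 2) (by linarith)
      have h2 : (y - B / 2) ^ 2 ≤ 0 := by nlinarith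
      have h3 : (y - B / 2) = 0 := by
        exact pow_eq_zero_iff (two_ne_zero) |>.1 (le_antisymm h2 (sq_nonneg _))
      linarith
    · rw [max_eq_right (by linarith)]
      have := h 0 le_rfl
      by_contra hne
      have hpos : 0 < y := lt_of_le_of_ne hy (Ne.symm hne)
      nlinarith
  · rintro rfl
    refine ⟨le_max_right _ _, fun x hx => ?_⟩
    rcases le_total 0 B with hB | hB
    · rw [max_eq_left (by linarith)]
      nlinarith [sq_nonneg (x - B / 2)]
    · rw [max_eq_right (by linarith)]
      nlinarith

theorem isNash_iff {k : ℕ} (A : ℝ) (q : Fin k → ℝ) :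
    IsNash A q ↔ ∀ i, q i = max A 0 / ((k : ℝ) + 1) := by
  have hk : (0 : ℝ) < (k : ℝ) + 1 := by positivity
  have key : ∀ i, ∑ r ∈ univ.erase i, q r = ∑ r, q r - q i := fun i => by
    rw [← Finset.add_sum_erase univ q (mem_univ i)]; ring
  unfold IsNash
  simp only [isMax_iff, key]
  constructor
  · intro h
    have hval : ∀ i, q i = max (A - ∑ r, q r) 0 := by
      intro i
      have := h i
      rcases le_total 0 ((A - (∑ r, q r - q i)) / 2) with h1 | h1
      · rw [max_eq_left h1] at this
        rw [max_eq_left (by linarith)]; linarith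
      · rw [max_eq_right h1] at this
        rw [max_eq_right (by linarith)]; exact this
    have hsum : ∑ r, q r = k * max (A - ∑ r, q r) 0 := by
      conv_lhs => rw [Finset.sum_congr rfl (fun i _ => hval i)]
      simp
    intro i
    rw [hval i, eq_div_iff hk.ne']
    rcases le_total 0 (A - ∑ r, q r) with h1 | h1
    · rw [max_eq_left h1] at hsum ⊢
      have hk0 : (0 : ℝ) ≤ k := by positivity
      rw [max_eq_left (by nlinarith)]
      linarith
    · rw [max_eq_right h1] at hsum ⊢
      rw [max_eq_right (by linarith)]
      ring
  · intro h i
    have hsum : ∑ r, q r = k * (max A 0 / ((k : ℝ) + 1)) := by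
      rw [Finset.sum_congr rfl (fun i _ => h i)]; simp
    rw [hsum, h i]
    rcases le_total 0 A with h1 | h1
    · rw [max_eq_left h1]
      have : (A - (k * (A / ((k : ℝ) + 1)) - A / ((k : ℝ) + 1))) / 2 = A / ((k : ℝ) + 1) := by
        field_simp; ring
      rw [this, max_eq_left (by positivity)]
    · rw [max_eq_right h1]
      simp only [zero_div, mul_zero, sub_zero]
      rw [max_eq_right (by linarith)]

theorem outsidersProfit_eq_of_isNash {a c : ℝ} (hca : c < a) (j : ℕ) (q : Fin (j + 1) → ℝ)
    (hq : IsNash (a - c) q) (i₀ : Fin (j + 1)) :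
    outsidersProfit a c j = ∑ i ∈ univ.erase i₀, (a - ∑ r, q r - c) * q i := by
  rw [isNash_iff, max_eq_left (by linarith)] at hq
  have hj : (0 : ℝ) < (j : ℝ) + 2 := by positivity
  simp only [hq]
  simp only [sum_const, card_univ, Fintype.card_fin, card_erase_of_mem (mem_univ i₀), nsmul_eq_mul,
    outsidersProfit]
  push_cast
  have : ((j : ℝ) + 1 + 1) = j + 2 := by ring
  rw [this]
  field_simp
  ring

theorem bigF_bounds {m : ℕ} {f : ℕ → ℝ} (hf : IsDistribution m f) :
    0 ≤ bigF m f ∧ bigF m f ≤ 1 ∧ ∑ j ∈ range (m + 1), f j / ((j : ℝ) + 1) = 1 - bigF m f := by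
  have h1 : ∑ j ∈ range (m + 1), f j / ((j : ℝ) + 1) = 1 - bigF m f := by
    rw [eq_sub_iff_add_eq, bigF, ← Finset.sum_add_distrib]
    refine Eq.trans ?_ hf.2.2
    refine Finset.sum_congr rfl fun j _ => ?_
    have : (0 : ℝ) < (j : ℝ) + 1 := by positivity
    rw [← add_div, div_eq_iff this.ne']
    ring
  have h2 : 0 ≤ ∑ j ∈ range (m + 1), f j / ((j : ℝ) + 1) :=
    Finset.sum_nonneg fun j hj =>
      div_nonneg (hf.1 j (by simpa [Nat.lt_succ_iff] using hj)) (by positivity)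
  refine ⟨Finset.sum_nonneg fun j hj => div_nonneg
    (mul_nonneg (by positivity) (hf.1 j (by simpa [Nat.lt_succ_iff] using hj))) (by positivity),
    by linarith, h1⟩

theorem expectedProfit_eq {a c : ℝ} {m : ℕ} {f : ℕ → ℝ} (hf : IsDistribution m f)
    {A : ℝ} {q : (j : ℕ) → Fin j → ℝ} (hq : ∀ j ≤ m, ∀ i, q j i = A / ((j : ℝ) + 1)) (x : ℝ) :
    expectedProfit a c m f q x = ((a - c - bigF m f * A) - x) * x := by
  have h : expectedProfit a c m f q x =
      ∑ j ∈ range (m + 1), ((a - c - x) * x * f j - A * x * ((j : ℝ) * f j / ((j : ℝ) + 1))) := by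
    refine Finset.sum_congr rfl fun j hj => ?_
    have hj' : j ≤ m := by simpa [Nat.lt_succ_iff] using hj
    rw [Finset.sum_congr rfl (fun i _ => hq j hj' i)]
    simp only [sum_const, card_univ, Fintype.card_fin, nsmul_eq_mul]
    ring
  rw [h, Finset.sum_sub_distrib, ← Finset.mul_sum, ← Finset.mul_sum, hf.2.2, ← bigF]
  ring

theorem exists_isEquilibrium {a c : ℝ} (hca : c < a) {m : ℕ} {f : ℕ → ℝ}
    (hf : IsDistribution m f) : ∃ qs q, IsEquilibrium a c m f qs q := by
  obtain ⟨h0, h1, -⟩ := bigF_bounds hf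
  have h2 : 0 < 2 - bigF m f := by linarith
  have hA : a - (1 - bigF m f) / (2 - bigF m f) * (a - c) - c = (a - c) / (2 - bigF m f) := by
    field_simp; ring
  have hA0 : 0 ≤ (a - c) / (2 - bigF m f) := div_nonneg (by linarith) h2.le
  refine ⟨(1 - bigF m f) / (2 - bigF m f) * (a - c),
    fun j _ => (a - c) / (2 - bigF m f) / ((j : ℝ) + 1), ?_, ?_⟩
  · simp only [expectedProfit_eq hf (A := (a - c) / (2 - bigF m f)) (fun _ _ _ => rfl)]
    rw [isMax_iff, max_eq_left]
    · field_simp; ring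
    · have : a - c - bigF m f * ((a - c) / (2 - bigF m f)) =
          2 * (1 - bigF m f) * ((a - c) / (2 - bigF m f)) := by field_simp; ring
      rw [this]
      have : 0 ≤ 1 - bigF m f := by linarith
      positivity
  · intro j _
    rw [isNash_iff, hA, max_eq_left hA0]
    exact fun _ => rfl

theorem expectedProfit_eq_value {a c : ℝ} (hca : c < a) {m : ℕ} {f : ℕ → ℝ}
    (hf : IsDistribution m f) {qs : ℝ} {q : (j : ℕ) → Fin j → ℝ}
    (h : IsEquilibrium a c m f qs q) : expectedProfit a c m f q qs = value a c m f := by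
  obtain ⟨h0, h1, hh⟩ := bigF_bounds hf
  have h2 : 0 < 2 - bigF m f := by linarith
  obtain ⟨hS, hN⟩ := h
  simp only [isNash_iff] at hN
  have hP := expectedProfit_eq (a := a) (c := c) hf hN
  simp only [hP, isMax_iff] at hS
  rw [hP]
  have hlt : 0 ≤ a - qs - c := by
    by_contra hneg
    rw [max_eq_right (a := a - qs - c) (by linarith), mul_zero, sub_zero,
      max_eq_left (by linarith)] at hS
    linarith
  rw [max_eq_left hlt] at hS ⊢
  have hqs0 : 0 ≤ qs := hS ▸ le_max_right _ _
  have hB : 0 ≤ a - c - bigF m f * (a - qs - c) := by nlinarith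
  rw [max_eq_left (by linarith)] at hS
  have hqs : qs = (1 - bigF m f) * (a - c) / (2 - bigF m f) := by
    rw [eq_div_iff h2.ne']; linarith
  rw [value, hh, show a - c - bigF m f * (a - qs - c) - qs = qs by linarith, hqs]
  field_simp

/-! The beliefs defined above are probability distributions. -/

theorem isBeliefSystem_beliefs (a c lam : ℝ) (n : ℕ) : IsBeliefSystem n (beliefs a c lam n) := by
  intro s _ _
  have hpos : 0 < ∑ m ∈ Finset.range (n - s + 1),
      Real.exp (lam * outsidersProfit a c m) * (Nat.stirlingSecond (n - s) m : ℝ) := by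
    refine Finset.sum_pos' (fun _ _ => by positivity) ⟨n - s, by simp, ?_⟩
    rw [Nat.stirlingSecond_self]; positivity
  refine ⟨fun j _ => by unfold beliefs; positivity, fun h => ?_, ?_⟩
  · obtain ⟨k, hk⟩ := Nat.exists_eq_succ_of_ne_zero h.ne'
    simp [beliefs, hk]
  · unfold beliefs
    rw [← Finset.sum_div, div_self hpos.ne']

theorem isBeliefSystem_singletonBeliefs (n : ℕ) : IsBeliefSystem n (singletonBeliefs n) := by
  intro s _ _
  refine ⟨fun j _ => by unfold singletonBeliefs; split_ifs <;> norm_num, fun h => ?_, ?_⟩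
  · simp [singletonBeliefs]; omega
  · simp [singletonBeliefs]

end CournotCore

end

/-! Let `G` be the expectation of `1 / (j + 1)`. Since `F = 1 - G`, the worth of a coalition is `(a
- c) ^ 2 * (G / (1 + G)) ^ 2`, increasing in `G`. First-order dominance lowers `G`, hence every
worth, while the grand coalition faces no outsiders and keeps its worth `(a - c) ^ 2 / 4`. This
gives the core inclusions (`core_subset_of_dominates`), and reduces non-emptiness to the beliefs
`f`.

For these the equal split is in the core once `4 * n * (G / (1 + G)) ^ 2 ≤ s`. If at most half the
firms are outside, `G ≤ 1 / 2` suffices. Otherwise `m = n - s` is large and almost all partitions of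
the outsiders have more than about `√m` blocks: at most `k ^ m` have `k` or fewer, but at least `(2
* k) ^ (m - 2 * k)` have `2 * k`. Logit weights change this by a bounded factor only, so `G ≤ 1 / (2
* √(m + 1))` (`exists_meanInv_beliefs_sq_le`). -/

namespace CournotCore

/-! ### Monotonicity of worths and core inclusion -/

/-- The expectation of `1 / (j + 1)` under the weights `f` on `0, …, m`. -/
noncomputable def meanInv (m : ℕ) (f : ℕ → ℝ) : ℝ := ∑ j ∈ range (m + 1), f j / ((j : ℝ) + 1)

theorem value_eq_meanInv (a c : ℝ) {m : ℕ} {f : ℕ → ℝ} (hf : IsDistribution m f) :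
    value a c m f = (a - c) ^ 2 * (meanInv m f / (1 + meanInv m f)) ^ 2 := by
  obtain ⟨-, -, h⟩ := bigF_bounds hf
  have h' : bigF m f = 1 - meanInv m f := by rw [meanInv, h]; ring
  rw [value, h', ← meanInv, show 2 - (1 - meanInv m f) = 1 + meanInv m f by ring,
    sub_sub_cancel, div_pow]
  ring

theorem meanInv_nonneg {m : ℕ} {f : ℕ → ℝ} (hf : IsDistribution m f) : 0 ≤ meanInv m f :=
  sum_nonneg fun j hj => div_nonneg (hf.1 j (by simpa [Nat.lt_succ_iff] using hj)) (by positivity)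

theorem value_mono (a c : ℝ) {m : ℕ} {f g : ℕ → ℝ} (hf : IsDistribution m f)
    (hg : IsDistribution m g) (h : meanInv m f ≤ meanInv m g) :
    value a c m f ≤ value a c m g := by
  rw [value_eq_meanInv a c hf, value_eq_meanInv a c hg]
  have h0 := meanInv_nonneg hf
  have h1 : meanInv m f / (1 + meanInv m f) ≤ meanInv m g / (1 + meanInv m g) := by
    rw [div_le_div_iff₀ (by linarith) (by linarith)]
    nlinarith
  have h2 : 0 ≤ meanInv m f / (1 + meanInv m f) := by positivity
  gcongr

/-- Abel summation: dominance compares partial sums, and for decreasing `w ≥ 0` each of them enters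
with a nonnegative coefficient. -/
theorem sum_mul_eq_sum_partial (m : ℕ) (g w : ℕ → ℝ) :
    ∑ j ∈ range (m + 1), g j * w j =
      (∑ j ∈ range (m + 1), g j) * w m +
        ∑ k ∈ range m, (∑ j ∈ range (k + 1), g j) * (w k - w (k + 1)) := by
  induction m with
  | zero => simp
  | succ m ih =>
    rw [sum_range_succ, ih, sum_range_succ g (m + 1),
      sum_range_succ (fun k => (∑ j ∈ range (k + 1), g j) * (w k - w (k + 1))) m]
    ring

/-- First-order dominance lowers the expectation of a decreasing function. -/
theorem meanInv_le_of_dominates {m : ℕ} {z f : ℕ → ℝ}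
    (h : ∀ k ≤ m, ∑ j ∈ range (k + 1), z j ≤ ∑ j ∈ range (k + 1), f j) :
    meanInv m z ≤ meanInv m f := by
  simp only [meanInv, div_eq_mul_inv]
  rw [sum_mul_eq_sum_partial, sum_mul_eq_sum_partial m f]
  refine add_le_add (mul_le_mul_of_nonneg_right (h m le_rfl) (by positivity))
    (sum_le_sum fun k hk => mul_le_mul_of_nonneg_right (h k (mem_range.1 hk).le) ?_)
  rw [sub_nonneg]
  push_cast
  gcongr
  linarith

theorem meanInv_zero {f : ℕ → ℝ} (hf : IsDistribution 0 f) : meanInv 0 f = 1 := by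
  have := hf.2.2
  simpa [meanInv] using this

theorem value_zero (a c : ℝ) {f : ℕ → ℝ} (hf : IsDistribution 0 f) :
    value a c 0 f = (a - c) ^ 2 / 4 := by
  rw [value_eq_meanInv a c hf, meanInv_zero hf]
  ring

theorem worth_univ_eq (a c : ℝ) {n : ℕ} {z f : ℕ → ℕ → ℝ} (hz : IsBeliefSystem n z)
    (hf : IsBeliefSystem n f) : worth a c n z univ = worth a c n f univ := by
  unfold worth
  split_ifs with h
  · rfl
  · have hn : 1 ≤ n := by
      simpa [Nat.one_le_iff_ne_zero] using card_ne_zero.2 (nonempty_iff_ne_empty.2 h)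
    have hz' := hz n hn le_rfl
    have hf' := hf n hn le_rfl
    rw [Nat.sub_self] at hz' hf'
    rw [Finset.card_fin, Nat.sub_self, value_zero a c hz', value_zero a c hf']

theorem worth_le_of_dominates (a c : ℝ) {n : ℕ} {z f : ℕ → ℕ → ℝ} (hz : IsBeliefSystem n z)
    (hf : IsBeliefSystem n f) (h : Dominates n z f) (S : Finset (Fin n)) :
    worth a c n z S ≤ worth a c n f S := by
  unfold worth
  split_ifs with hS
  · rfl
  · have h1 : 1 ≤ S.card := card_pos.2 (nonempty_iff_ne_empty.2 hS)
    have h2 : S.card ≤ n := card_finset_fin_le S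
    exact value_mono a c (hz _ h1 h2) (hf _ h1 h2) (meanInv_le_of_dominates (h _ h1 h2))

theorem core_subset_of_dominates (a c : ℝ) {n : ℕ} {z f : ℕ → ℕ → ℝ} (hz : IsBeliefSystem n z)
    (hf : IsBeliefSystem n f) (h : Dominates n z f) :
    core (worth a c n f) ⊆ core (worth a c n z) := fun _ hx =>
  ⟨hx.1.trans (worth_univ_eq a c hf hz),
    fun S => (worth_le_of_dominates a c hz hf h S).trans (hx.2 S)⟩

theorem singletonBeliefs_dominates {n : ℕ} {f : ℕ → ℕ → ℝ} (hf : IsBeliefSystem n f) :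
    Dominates n (singletonBeliefs n) f := by
  intro s h1 h2 k hk
  obtain ⟨h0, -, hs⟩ := hf s h1 h2
  rcases hk.eq_or_lt with rfl | hlt
  · rw [hs, (isBeliefSystem_singletonBeliefs n s h1 h2).2.2]
  · rw [sum_eq_zero]
    · exact sum_nonneg fun j hj => h0 j (by have := mem_range.1 hj; omega)
    · intro j hj
      have := mem_range.1 hj
      rw [singletonBeliefs, if_neg (by omega)]

/-! Bounds on Stirling numbers of the second kind. -/

/-- Put `k` elements into separate blocks; the other `m` may join these blocks arbitrarily. -/
theorem pow_le_stirlingSecond (k m : ℕ) : k ^ m ≤ Nat.stirlingSecond (m + k) k := by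
  induction m with
  | zero => simp [Nat.stirlingSecond_self]
  | succ m ih =>
    rcases k with _ | k
    · simp
    · rw [show m + 1 + (k + 1) = (m + (k + 1)) + 1 by ring, Nat.stirlingSecond_succ_succ,
        pow_succ, mul_comm]
      exact (Nat.mul_le_mul_left _ ih).trans (Nat.le_add_right _ _)

/-- A partition into at most `k` blocks arises from a labelling of the elements by `k` labels. The
induction uses the Stirling recurrence instead. -/
theorem sum_stirlingSecond_le_pow (k m : ℕ) :
    ∑ j ∈ range (k + 1), Nat.stirlingSecond m j ≤ k ^ m := by
  induction m with
  | zero =>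
    rw [sum_range_succ']
    simp
  | succ m ih =>
    calc ∑ j ∈ range (k + 1), Nat.stirlingSecond (m + 1) j
        = ∑ j ∈ range k, (j + 1) * Nat.stirlingSecond m (j + 1) +
            ∑ j ∈ range k, Nat.stirlingSecond m j := by
          rw [sum_range_succ', ← sum_add_distrib]
          simp [Nat.stirlingSecond_succ_succ]
      _ = ∑ j ∈ range (k + 1), j * Nat.stirlingSecond m j +
            ∑ j ∈ range k, Nat.stirlingSecond m j := by
          rw [sum_range_succ' (fun j => j * Nat.stirlingSecond m j)]
          simp
      _ = ∑ j ∈ range k, (j + 1) * Nat.stirlingSecond m j + k * Nat.stirlingSecond m k := by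
          rw [sum_range_succ, add_right_comm, ← sum_add_distrib]
          simp only [add_mul, one_mul]
      _ ≤ ∑ j ∈ range k, k * Nat.stirlingSecond m j + k * Nat.stirlingSecond m k := by
          gcongr with j hj
          exact mem_range.1 hj
      _ = k * ∑ j ∈ range (k + 1), Nat.stirlingSecond m j := by
          rw [sum_range_succ, mul_add, mul_sum]
      _ ≤ k ^ (m + 1) := by
          rw [pow_succ, mul_comm (k ^ m)]
          exact Nat.mul_le_mul_left _ ih

/-! ### Smallness of the expectation under the beliefs -/

theorem outsidersProfit_nonneg (a c : ℝ) (j : ℕ) : 0 ≤ outsidersProfit a c j := by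
  unfold outsidersProfit
  positivity

theorem outsidersProfit_le (a c : ℝ) (j : ℕ) : outsidersProfit a c j ≤ (a - c) ^ 2 := by
  have hj : (0 : ℝ) ≤ j := by positivity
  rw [outsidersProfit, div_pow, mul_div_assoc', div_le_iff₀ (by positivity), mul_comm]
  gcongr
  nlinarith

/-- Splitting the structures at `k` coalitions bounds the expectation of `1 / (j + 1)`, since
the weights `exp (lam * Π_j)` lie between `1` and `exp ((a - c) ^ 2)`. -/
theorem meanInv_beliefs_le {a c lam : ℝ} (h0 : 0 ≤ lam) (h1 : lam ≤ 1) {n s k : ℕ} (hk : 1 ≤ k)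
    (hkm : 2 * k ≤ n - s) :
    meanInv (n - s) (beliefs a c lam n s) ≤
      Real.exp ((a - c) ^ 2) * (k : ℝ) ^ (n - s) / (2 * (k : ℝ)) ^ (n - s - 2 * k) +
        1 / ((k : ℝ) + 1) := by
  set m := n - s with hm
  set C := Real.exp ((a - c) ^ 2)
  set w : ℕ → ℝ := fun j => Real.exp (lam * outsidersProfit a c j) with hw
  set D := ∑ j ∈ range (m + 1), w j * (Nat.stirlingSecond m j : ℝ) with hD
  have hw1 : ∀ j, 1 ≤ w j := fun j =>
    Real.one_le_exp (mul_nonneg h0 (outsidersProfit_nonneg a c j))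
  have hw0 : ∀ j, 0 ≤ w j := fun j => zero_le_one.trans (hw1 j)
  have hwC : ∀ j, w j ≤ C := fun j => Real.exp_le_exp.2
    ((mul_le_of_le_one_left (outsidersProfit_nonneg a c j) h1).trans (outsidersProfit_le a c j))
  have hk0 : (0 : ℝ) < k := by exact_mod_cast hk
  have hP : (0 : ℝ) < (2 * (k : ℝ)) ^ (m - 2 * k) := by positivity
  -- The single term `j = 2 * k` already bounds the normalizer; its base `2 * k` against `k` is the
  -- source of a gain of `2 ^ m`.
  have hDP : (2 * (k : ℝ)) ^ (m - 2 * k) ≤ D := by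
    have h := pow_le_stirlingSecond (2 * k) (m - 2 * k)
    rw [Nat.sub_add_cancel hkm] at h
    have h' : (2 * (k : ℝ)) ^ (m - 2 * k) ≤ (Nat.stirlingSecond m (2 * k) : ℝ) := by
      exact_mod_cast h
    refine h'.trans ((le_mul_of_one_le_left (by positivity) (hw1 (2 * k))).trans ?_)
    exact single_le_sum (f := fun j => w j * (Nat.stirlingSecond m j : ℝ))
      (fun j _ => mul_nonneg (hw0 j) (by positivity)) (mem_range.2 (by omega))
  have hD0 : 0 < D := hP.trans_le hDP
  have hsum : ((∑ j ∈ range (k + 1), Nat.stirlingSecond m j : ℕ) : ℝ) ≤ (k : ℝ) ^ m := by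
    exact_mod_cast sum_stirlingSecond_le_pow k m
  push_cast at hsum
  have hnum : ∑ j ∈ range (m + 1), w j * (Nat.stirlingSecond m j : ℝ) / ((j : ℝ) + 1) ≤
      C * (k : ℝ) ^ m + D / ((k : ℝ) + 1) := by
    rw [← sum_range_add_sum_Ico _ (show k + 1 ≤ m + 1 by omega)]
    refine add_le_add ?_ ?_
    · refine le_trans ?_ (mul_le_mul_of_nonneg_left hsum (Real.exp_pos _).le)
      rw [mul_sum]
      refine sum_le_sum fun j _ => ?_
      refine (div_le_self (mul_nonneg (hw0 j) (by positivity)) (by simp)).trans ?_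
      exact mul_le_mul_of_nonneg_right (hwC j) (by positivity)
    · rw [hD, sum_div, ← sum_range_add_sum_Ico _ (show k + 1 ≤ m + 1 by omega)]
      refine le_add_of_nonneg_of_le (sum_nonneg fun j _ => div_nonneg
        (mul_nonneg (hw0 j) (by positivity)) (by positivity)) (sum_le_sum fun j hj => ?_)
      have hj' : (k : ℝ) ≤ j := by
        have := (mem_Ico.1 hj).1
        exact_mod_cast (by omega : k ≤ j)
      have := mul_nonneg (hw0 j) (Nat.cast_nonneg (α := ℝ) (Nat.stirlingSecond m j))
      gcongr
  have hG : meanInv m (beliefs a c lam n s) =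
      (∑ j ∈ range (m + 1), w j * (Nat.stirlingSecond m j : ℝ) / ((j : ℝ) + 1)) / D := by
    rw [meanInv, sum_div]
    exact sum_congr rfl fun j _ => div_right_comm _ _ _
  rw [hG, div_le_iff₀ hD0]
  refine hnum.trans ?_
  rw [add_mul, one_div_mul_eq_div]
  refine add_le_add_left ?_ _
  rw [div_mul_eq_mul_div, le_div_iff₀ hP]
  exact mul_le_mul_of_nonneg_left hDP (by positivity)

/-- Eventually `(8 * t) ^ 16 ≤ 2 ^ t`, so after taking 16th powers it is enough that `t * (8 * t +
2) ≤ 16 * (t - 1) ^ 2`. -/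
theorem eventually_pow_le_two_pow :
    ∀ᶠ t : ℕ in Filter.atTop, (8 * (t : ℝ)) ^ (8 * t + 2) ≤ 2 ^ ((t - 1) ^ 2) := by
  have h := (isLittleO_pow_const_const_pow_of_one_lt (R := ℝ) 16 (r := 2) (by norm_num)).bound
    (c := 1 / 8 ^ 16) (by positivity)
  filter_upwards [h, Filter.eventually_ge_atTop 6] with t ht ht6
  have ht' : (8 * (t : ℝ)) ^ 16 ≤ 2 ^ t := by
    rw [Real.norm_of_nonneg (by positivity), Real.norm_of_nonneg (by positivity)] at ht
    rw [mul_pow]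
    rw [one_div, inv_mul_eq_div, le_div_iff₀ (by positivity)] at ht
    linarith
  rw [← pow_le_pow_iff_left₀ (by positivity) (by positivity) (show 16 ≠ 0 by norm_num)]
  calc ((8 * (t : ℝ)) ^ (8 * t + 2)) ^ 16
      = ((8 * (t : ℝ)) ^ 16) ^ (8 * t + 2) := pow_right_comm _ _ _
    _ ≤ (2 ^ t) ^ (8 * t + 2) := by gcongr
    _ = 2 ^ (t * (8 * t + 2)) := (pow_mul _ _ _).symm
    _ ≤ 2 ^ ((t - 1) ^ 2 * 16) := by
        refine pow_le_pow_right₀ (by norm_num) ?_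
        obtain ⟨u, rfl⟩ : ∃ u, t = u + 1 := ⟨t - 1, by omega⟩
        rw [Nat.add_sub_cancel]
        nlinarith
    _ = (2 ^ ((t - 1) ^ 2)) ^ 16 := pow_mul _ _ _

theorem exists_meanInv_beliefs_sq_le (a c : ℝ) {lam : ℝ} (h0 : 0 ≤ lam) (h1 : lam ≤ 1) :
    ∃ m₀ : ℕ, ∀ n s : ℕ, m₀ ≤ n - s →
      4 * meanInv (n - s) (beliefs a c lam n s) ^ 2 * ((n - s : ℕ) + 1) ≤ 1 := by
  -- The bound `12 ≤ t` gives `8 * t ≤ (t - 1) ^ 2`; the last condition lets `t` absorb the logit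
  -- constant.
  obtain ⟨t₀, ht₀⟩ := Filter.eventually_atTop.1 (eventually_pow_le_two_pow.and
    ((Filter.eventually_ge_atTop 12).and
      (tendsto_natCast_atTop_atTop.eventually_ge_atTop (Real.exp ((a - c) ^ 2)))))
  refine ⟨t₀ ^ 2, fun n s hm => ?_⟩
  -- Here `(t - 1) ^ 2 ≤ m < t ^ 2`. The cut `k = 4 * t` makes each of the two terms at most `1 / (4
  -- * t)`.
  set t := Nat.sqrt (n - s) + 1 with ht
  have htt : t₀ ≤ t := (Nat.le_sqrt'.2 hm).trans (Nat.le_succ _)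
  obtain ⟨hpow, ht12, htC⟩ := ht₀ t htt
  have hlow : (t - 1) ^ 2 ≤ n - s := by simpa [ht] using Nat.sqrt_le' (n - s)
  have hup : n - s + 1 ≤ t ^ 2 := Nat.succ_le_of_lt (Nat.lt_succ_sqrt' (n - s))
  have h8 : 2 * (4 * t) ≤ n - s := by
    refine le_trans ?_ hlow
    obtain ⟨u, hu⟩ : ∃ u, t = u + 1 := ⟨t - 1, by omega⟩
    rw [hu, Nat.add_sub_cancel]
    nlinarith
  have hG := meanInv_beliefs_le (a := a) (c := c) h0 h1 (show 1 ≤ 4 * t by omega) h8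
  have hGnn : 0 ≤ meanInv (n - s) (beliefs a c lam n s) := by
    unfold meanInv beliefs
    exact sum_nonneg fun j _ => by positivity
  set G := meanInv (n - s) (beliefs a c lam n s)
  set m := n - s
  have ht0 : (0 : ℝ) < t := by
    have : 0 < t := by omega
    exact_mod_cast this
  have hC := Real.exp_pos ((a - c) ^ 2)
  set C := Real.exp ((a - c) ^ 2)
  push_cast at hG
  have hx : (2 * (4 * (t : ℝ))) = 8 * t := by ring
  rw [hx, show 2 * (4 * t) = 8 * t by ring] at hG
  rw [show 2 * (4 * t) = 8 * t by ring] at h8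
  have hfirst : C * (4 * (t : ℝ)) ^ m / (8 * (t : ℝ)) ^ (m - 8 * t) ≤ 1 / (4 * t) := by
    rw [div_le_div_iff₀ (by positivity) (by positivity), one_mul,
      ← mul_le_mul_iff_left₀ (show (0 : ℝ) < (8 * t) ^ (8 * t) by positivity), ← pow_add,
      Nat.sub_add_cancel h8]
    calc C * (4 * (t : ℝ)) ^ m * (4 * t) * (8 * t) ^ (8 * t)
        = (C * (4 * t)) * (8 * t) ^ (8 * t) * (4 * (t : ℝ)) ^ m := by ring
      _ ≤ (8 * t) ^ 2 * (8 * t) ^ (8 * t) * (4 * (t : ℝ)) ^ m := by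
          gcongr
          nlinarith
      _ = (8 * t) ^ (8 * t + 2) * (4 * (t : ℝ)) ^ m := by rw [pow_add]; ring
      _ ≤ 2 ^ m * (4 * (t : ℝ)) ^ m := by
          gcongr
          exact hpow.trans (pow_le_pow_right₀ (by norm_num) hlow)
      _ = (8 * (t : ℝ)) ^ m := by rw [← mul_pow]; ring
  have hsecond : 1 / (4 * (t : ℝ) + 1) ≤ 1 / (4 * t) := by
    gcongr
    linarith
  have hGt : G * (2 * t) ≤ 1 := by
    have : G ≤ 1 / (2 * t) := by
      refine (hG.trans (add_le_add hfirst hsecond)).trans_eq ?_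
      field_simp
      norm_num
    rwa [le_div_iff₀ (by positivity)] at this
  have hup' : (m : ℝ) + 1 ≤ (t : ℝ) ^ 2 := by exact_mod_cast hup
  calc 4 * G ^ 2 * ((m : ℝ) + 1) ≤ 4 * G ^ 2 * (t : ℝ) ^ 2 := by gcongr
    _ = (G * (2 * t)) ^ 2 := by ring
    _ ≤ 1 := pow_le_one₀ (by positivity) hGt

/-! ### Worth per member and non-emptiness of the core -/

theorem meanInv_le_half {m : ℕ} (hm : 0 < m) {f : ℕ → ℝ} (hf : IsDistribution m f) :
    meanInv m f ≤ 1 / 2 := by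
  obtain ⟨h0, h1, h2⟩ := hf
  rw [meanInv, show (1 / 2 : ℝ) = ∑ j ∈ range (m + 1), 1 / 2 * f j by rw [← mul_sum, h2, mul_one]]
  refine sum_le_sum fun j hj => ?_
  rcases Nat.eq_zero_or_pos j with rfl | hj0
  · simp [h1 hm]
  · have hj1 : (1 : ℝ) ≤ j := by exact_mod_cast hj0
    rw [div_le_iff₀ (by positivity)]
    nlinarith [h0 j (by simpa [Nat.lt_succ_iff] using hj)]

/-- A symmetric game has a non-empty core if the grand coalition has the largest worth per
member. -/
theorem core_nonempty_of_card_mul_le {n : ℕ} {v : Finset (Fin n) → ℝ} (h0 : v ∅ = 0)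
    (h : ∀ S : Finset (Fin n), S.Nonempty → n * v S ≤ S.card * v univ) : (core v).Nonempty := by
  refine ⟨fun _ => v univ / n, ?_, fun S => ?_⟩
  · rcases Nat.eq_zero_or_pos n with rfl | hn
    · simpa using h0.symm
    · have : (n : ℝ) ≠ 0 := by positivity
      simp [mul_div_cancel₀ _ this]
  · rcases S.eq_empty_or_nonempty with rfl | hS
    · simp [h0]
    · have hn : (0 : ℝ) < n := by
        exact_mod_cast (card_pos.2 hS).trans_le (card_finset_fin_le S)
      rw [sum_const, nsmul_eq_mul, mul_div_assoc', le_div_iff₀ hn, mul_comm]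
      exact h S hS

theorem exists_mul_value_beliefs_le (a c : ℝ) {lam : ℝ} (h0 : 0 ≤ lam) (h1 : lam ≤ 1) :
    ∃ n₀ : ℕ, ∀ n s : ℕ, n₀ ≤ n → 1 ≤ s → s ≤ n →
      n * value a c (n - s) (beliefs a c lam n s) ≤ s * ((a - c) ^ 2 / 4) := by
  obtain ⟨m₀, hm₀⟩ := exists_meanInv_beliefs_sq_le a c h0 h1
  refine ⟨2 * m₀, fun n s hn hs1 hsn => ?_⟩
  have hf := isBeliefSystem_beliefs a c lam n s hs1 hsn
  rw [value_eq_meanInv a c hf]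
  have hG0 := meanInv_nonneg hf
  have hs' : (1 : ℝ) ≤ s := by exact_mod_cast hs1
  have hsn' : (s : ℝ) ≤ n := by exact_mod_cast hsn
  suffices hmain : 4 * (n * (meanInv (n - s) (beliefs a c lam n s) /
      (1 + meanInv (n - s) (beliefs a c lam n s))) ^ 2) ≤ s by
    nlinarith [sq_nonneg (a - c)]
  rcases Nat.eq_zero_or_pos (n - s) with hm | hm
  · rw [hm] at hf ⊢
    have : n = s := by omega
    rw [meanInv_zero hf, this]
    linarith
  -- With few outsiders `4 * n / 9 ≤ 8 * s / 9`; otherwise `n - s > n / 2 ≥ m₀`, so the asymptotic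
  -- bound applies.
  by_cases hsmall : 2 * (n - s) ≤ n
  · have hG := meanInv_le_half hm hf
    set G := meanInv (n - s) (beliefs a c lam n s)
    have hq : G / (1 + G) ≤ 1 / 3 := by
      rw [div_le_div_iff₀ (by linarith) (by norm_num)]
      linarith
    have hq0 : 0 ≤ G / (1 + G) := by positivity
    have hq2 : (G / (1 + G)) ^ 2 ≤ (1 / 3) ^ 2 := by gcongr
    have : (n : ℝ) ≤ 2 * s := by exact_mod_cast (by omega : n ≤ 2 * s)
    nlinarith
  · have hG := hm₀ n s (by omega)
    set G := meanInv (n - s) (beliefs a c lam n s)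
    have hq0 : 0 ≤ G / (1 + G) := by positivity
    have hq : G / (1 + G) ≤ G := div_le_self hG0 (by linarith)
    have hq2 : (G / (1 + G)) ^ 2 ≤ G ^ 2 := by gcongr
    rw [Nat.cast_sub hsn] at hG
    -- The difference of the two sides is `(s - 1) * (n - s) ≥ 0`.
    have hns : (n : ℝ) ≤ s * (n - s + 1) := by nlinarith
    calc 4 * (n * (G / (1 + G)) ^ 2) ≤ 4 * ((s * (n - s + 1)) * G ^ 2) := by gcongr
      _ = s * (4 * G ^ 2 * (n - s + 1)) := by ring
      _ ≤ s := mul_le_of_le_one_right (by linarith) hG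

theorem exists_core_beliefs_nonempty (a c : ℝ) {lam : ℝ} (h0 : 0 ≤ lam) (h1 : lam ≤ 1) :
    ∃ n₀ : ℕ, ∀ n : ℕ, n₀ ≤ n → (core (worth a c n (beliefs a c lam n))).Nonempty := by
  obtain ⟨n₀, hn₀⟩ := exists_mul_value_beliefs_le a c h0 h1
  refine ⟨n₀, fun n hn => core_nonempty_of_card_mul_le (by simp [worth]) fun S hS => ?_⟩
  have hS1 : 1 ≤ S.card := card_pos.2 hS
  have hSn : S.card ≤ n := card_finset_fin_le S
  have huniv : (univ : Finset (Fin n)) ≠ ∅ := (hS.mono (subset_univ S)).ne_empty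
  have hf := isBeliefSystem_beliefs a c lam n n (hS1.trans hSn) le_rfl
  rw [Nat.sub_self] at hf
  rw [worth, if_neg hS.ne_empty, worth, if_neg huniv, Finset.card_fin, Nat.sub_self,
    value_zero a c hf]
  exact hn₀ n S.card hn hS1 hSn

end CournotCore

theorem proposition2 (a c : ℝ) (hc : 0 < c) (hca : c < a) (lam : ℝ) (hlam : lam = 0 ∨ lam = 1) :
    (∃ n₀ : ℕ, ∀ n : ℕ, n₀ ≤ n → ∀ z : ℕ → ℕ → ℝ,
      CournotCore.IsBeliefSystem n z →
      CournotCore.Dominates n z (CournotCore.beliefs a c lam n) →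
      (CournotCore.core (CournotCore.worth a c n z)).Nonempty) ∧
    (∀ n : ℕ, ∀ z : ℕ → ℕ → ℝ,
      CournotCore.IsBeliefSystem n z →
      CournotCore.Dominates n z (CournotCore.beliefs a c lam n) →
      CournotCore.core (CournotCore.worth a c n (CournotCore.beliefs a c lam n)) ⊆
        CournotCore.core (CournotCore.worth a c n z)) ∧
    (∀ n : ℕ,
      CournotCore.core (CournotCore.worth a c n (CournotCore.beliefs a c lam n)) ⊆
        CournotCore.core (CournotCore.worth a c n (CournotCore.singletonBeliefs n))) := by
  have h0 : 0 ≤ lam := by rcases hlam with rfl | rfl <;> norm_num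
  have h1 : lam ≤ 1 := by rcases hlam with rfl | rfl <;> norm_num
  have hf := CournotCore.isBeliefSystem_beliefs a c lam
  refine ⟨?_, fun n z hz h => CournotCore.core_subset_of_dominates a c hz (hf n) h, fun n =>
    CournotCore.core_subset_of_dominates a c (CournotCore.isBeliefSystem_singletonBeliefs n) (hf n)
      (CournotCore.singletonBeliefs_dominates (hf n))⟩
  obtain ⟨n₀, hn₀⟩ := CournotCore.exists_core_beliefs_nonempty a c h0 h1
  exact ⟨n₀, fun n hn z hz h =>
    (hn₀ n hn).mono (CournotCore.core_subset_of_dominates a c hz (hf n) h)⟩
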